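/- Let $\mathbb K\in\{\mathbb R,\mathbb C\}$ and let $(Y,\tau_Y)$ be a Hausdorff locally convex topological vector space over $\mathbb K$ which is quasi-$\ell_\infty$-barrelled, i.e. every bounded sequence in its strong dual is equicontinuous. Assume that the strong dual $X:=(Y',\beta(Y',Y))$ (the topological dual with the topology of uniform convergence on the bounded subsets of $Y$) is a separable Fréchet space, and let $T:X\to X$ be a continuous linear operator which is the adjoint of some linear map $S:Y\to Y$, i.e. $\langle Su,x\rangle=\langle u,Tx\rangle$ for all $u\in Y$, $x\in X$. Write $\mathcal O_T(x)=\{T^nx: n\ge 1\}$. We say that - $T$ is *hypercyclic* if $\mathcal O_T(x)$ is dense in $X$ for some $x\in X$; - $x\in X$ is *$\mathcal{AP}_b$-recurrent* if for every neighbourhood $U$ of $x$ there is $d\ge 1$ such that $\{n\ge 1: T^nx\in U\}$ contains arbitrarily long finite arithmetic progressions with common difference $d$; - $x\in X$ has *locally bounded orbit* if $U\cap\mathcal O_T(x)$ is bounded for some neighbourhood $U$ of $x$; - $T$ has *dense small bounded periodic sets* if every non-empty open set $U\subset X$ contains a non-empty bounded set $B$ such that $T^p(B)\subset B$ for some $p\ge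 1$; - $T$ is *Devaney chaotic* if $T$ is hypercyclic and the set of vectors $x$ with $T^px=x$ for some $p\ge 1$ is dense in $X$. Then the following are equivalent: 1. $T$ is hypercyclic and the set of $\mathcal{AP}_b$-recurrent vectors with locally bounded orbit is dense in $X$; 2. $T$ is hypercyclic and has dense small bounded periodic sets; 3. $T$ is Devaney chaotic. -/

import Mathlib

/-- The orbit `{T^n x ; n ≥ 1}` of `x` under `T`. -/
def forwardOrbit {X : Type*} (T : X → X) (x : X) : Set X :=
  {y | ∃ n : ℕ, 1 ≤ n ∧ T^[n] x = y}

/-- The return set `{n ≥ 1 ; T^n x ∈ E}`. -/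
def returnSet {X : Type*} (T : X → X) (x : X) (E : Set X) : Set ℕ :=
  {n | 1 ≤ n ∧ T^[n] x ∈ E}

/-- `T` is hypercyclic: some vector has a dense orbit. -/
def IsHypercyclic {X : Type*} [TopologicalSpace X] (T : X → X) : Prop :=
  ∃ x : X, Dense (forwardOrbit T x)

/-- Devaney chaos: `T` is hypercyclic and its periodic points
(`T^p x = x` for some `p ≥ 1`) are dense. -/
def IsDevaneyChaotic {X : Type*} [TopologicalSpace X] (T : X → X) : Prop :=
  IsHypercyclic T ∧ Dense (Function.periodicPts T)

/-- The set of `ℱ`-recurrent vectors of `T`, for a family `ℱ` of sets of natural numbers. -/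
def familyRec {X : Type*} [TopologicalSpace X] (ℱ : Set (Set ℕ)) (T : X → X) : Set X :=
  {x | ∀ U ∈ nhds x, returnSet T x U ∈ ℱ}

/-- The family of sets which contain arbitrarily long arithmetic progressions with a fixed
common difference `d ≥ 1`. -/
def arithProgBounded : Set (Set ℕ) :=
  {A | ∃ d : ℕ, 1 ≤ d ∧ ∀ L : ℕ, ∃ a : ℕ, ∀ j ≤ L, a + j * d ∈ A}

/-- The set of vectors with locally bounded orbit for `T`. -/
def locallyBoundedOrbit (𝕜 : Type*) {X : Type*} [NormedField 𝕜] [AddCommGroup X] [Module 𝕜 X]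
    [TopologicalSpace X] (T : X → X) : Set X :=
  {x | ∃ U ∈ nhds x, Bornology.IsVonNBounded 𝕜 (U ∩ forwardOrbit T x)}

/-- `T` has dense small bounded periodic sets: every non-empty open set `U` contains a non-empty
bounded set `B` with `T^p(B) ⊆ B` for some `p ≥ 1`. -/
def HasDenseSmallBoundedPeriodicSets (𝕜 : Type*) {X : Type*} [NormedField 𝕜] [AddCommGroup X]
    [Module 𝕜 X] [TopologicalSpace X] (T : X → X) : Prop :=
  ∀ U : Set X, IsOpen U → U.Nonempty →
    ∃ B : Set X, B ⊆ U ∧ B.Nonempty ∧ Bornology.IsVonNBounded 𝕜 B ∧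
      ∃ p : ℕ, 1 ≤ p ∧ T^[p] '' B ⊆ B

/-- `Y` is quasi-`ℓ_∞`-barrelled: every bounded sequence in its strong dual is equicontinuous.
The topology of `StrongDual 𝕜 Y` is that of uniform convergence on the bounded subsets of `Y`. -/
def IsQuasiLInftyBarrelled (𝕜 Y : Type*) [NormedField 𝕜] [AddCommGroup Y] [Module 𝕜 Y]
    [TopologicalSpace Y] : Prop :=
  ∀ f : ℕ → StrongDual 𝕜 Y, Bornology.IsVonNBounded 𝕜 (Set.range f) →
    Equicontinuous (fun n : ℕ => (f n : Y → 𝕜))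

open Filter Topology
open scoped Pointwise


/-! Conditions 1 and 2 both place, near any point of a dense set, a bounded set `C` containing
arbitrarily long segments of `T^d`-orbits. Separability and quasi-`ℓ_∞`-barrelledness make `C`
equicontinuous, so the averages over these segments have a pointwise ultrafilter limit `g` in the
dual. Telescoping and the adjoint `S` give `T^d g = g`. Basic neighbourhoods are convex and closed
under pointwise limits, so `g` stays near the point. Hypercyclicity is merely carried along. -/

section Dual

variable {𝕜 Y : Type*} [RCLike 𝕜] [AddCommGroup Y] [Module 𝕜 Y] [TopologicalSpace Y]

/-- In the strong dual of a quasi-`ℓ_∞`-barrelled space, if that dual is separable and metrizable,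
every bounded set is equicontinuous at the origin. -/
theorem IsQuasiLInftyBarrelled.eventually_norm_apply_le [IsTopologicalAddGroup Y]
    [ContinuousSMul 𝕜 Y] (hY : IsQuasiLInftyBarrelled 𝕜 Y)
    [TopologicalSpace.SeparableSpace (StrongDual 𝕜 Y)]
    [TopologicalSpace.PseudoMetrizableSpace (StrongDual 𝕜 Y)]
    {C : Set (StrongDual 𝕜 Y)} (hC : Bornology.IsVonNBounded 𝕜 C) {ε : ℝ} (hε : 0 < ε) :
    ∀ᶠ u in 𝓝 (0 : Y), ∀ c ∈ C, ‖c u‖ ≤ ε := by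
  rcases C.eq_empty_or_nonempty with rfl | hne
  · simp
  obtain ⟨D, hDC, hDc, hCD⟩ :=
    (TopologicalSpace.IsSeparable.of_separableSpace C).exists_countable_dense_subset
  have hDne : D.Nonempty := by
    rw [← closure_nonempty_iff]
    exact hne.mono hCD
  obtain ⟨f, rfl⟩ := hDc.exists_eq_range hDne
  have hf := Metric.equicontinuousAt_iff_right.1 (hY f (hC.subset hDC) 0) ε hε
  filter_upwards [hf] with u hu c hc
  have hcl : IsClosed {c : StrongDual 𝕜 Y | ‖c u‖ ≤ ε} :=
    isClosed_le (continuous_eval_const u).norm continuous_const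
  refine hcl.closure_subset_iff.2 ?_ (hCD hc)
  rintro _ ⟨n, rfl⟩
  have := hu n
  simp only [map_zero, dist_zero_left] at this
  exact this.le

/-- A sequence of functionals which is equicontinuous at the origin has a pointwise limit along
every ultrafilter, and this limit is a continuous functional. -/
theorem exists_tendsto_apply_of_eventually_norm_apply_le [IsTopologicalAddGroup Y]
    [ContinuousSMul 𝕜 Y] (𝒰 : Ultrafilter ℕ) {z : ℕ → StrongDual 𝕜 Y}
    (hz : ∀ ε : ℝ, 0 < ε → ∀ᶠ u in 𝓝 (0 : Y), ∀ n, ‖z n u‖ ≤ ε) :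
    ∃ g : StrongDual 𝕜 Y, ∀ u, Tendsto (fun n => z n u) 𝒰 (𝓝 (g u)) := by
  have hlim : ∀ u, ∃ a : 𝕜, Tendsto (fun n => z n u) 𝒰 (𝓝 a) := by
    intro u
    obtain ⟨r, hr, h⟩ := (absorbent_nhds_zero (𝕜 := 𝕜) (hz 1 one_pos)).absorbs
      (x := u) |>.exists_pos
    obtain ⟨c, hc⟩ := NormedField.exists_lt_norm 𝕜 r
    have hu : u ∈ c • {u | ∀ n, ‖z n u‖ ≤ 1} := h c hc.le rfl
    obtain ⟨v, hv, rfl⟩ := hu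
    obtain ⟨a, -, ha⟩ := (isCompact_closedBall (0 : 𝕜) ‖c‖).ultrafilter_le_nhds
      (𝒰.map fun n => z n (c • v)) (by
        refine le_principal_iff.2 (Ultrafilter.mem_map.2 (univ_mem' fun n => ?_))
        have := hv n
        simpa [norm_smul] using mul_le_of_le_one_right (norm_nonneg c) this)
    exact ⟨a, ha⟩
  choose g hg using hlim
  let G : Y →ₗ[𝕜] 𝕜 :=
    { toFun := g
      map_add' := fun u v => tendsto_nhds_unique (hg (u + v)) (by
        simpa only [map_add] using (hg u).add (hg v))
      map_smul' := fun c u => tendsto_nhds_unique (hg (c • u)) (by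
        simpa only [map_smul, RingHom.id_apply] using (hg u).const_smul c) }
  refine ⟨⟨G, ?_⟩, hg⟩
  refine continuous_of_continuousAt_zero G ?_
  rw [ContinuousAt, map_zero, Metric.tendsto_nhds]
  intro ε hε
  filter_upwards [hz (ε / 2) (half_pos hε)] with u hu
  rw [dist_zero_right]
  have : ‖G u‖ ≤ ε / 2 := le_of_tendsto (hg u).norm (Eventually.of_forall fun n => hu n)
  linarith

/-- Moves iterates of `T` onto the test vector, so that `T^n` respects pointwise limits of
functionals. -/
theorem apply_iterate_of_adjoint {T : StrongDual 𝕜 Y →L[𝕜] StrongDual 𝕜 Y} {S : Y →ₗ[𝕜] Y}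
    (hTS : ∀ (u : Y) (x : StrongDual 𝕜 Y), x (S u) = T x u) (n : ℕ) (x : StrongDual 𝕜 Y) (u : Y) :
    (T^[n] x) u = x (S^[n] u) := by
  induction n generalizing x with
  | zero => rfl
  | succ n ih => rw [Function.iterate_succ_apply, ih, Function.iterate_succ_apply', hTS]

/-- The average of the first `N + 1` iterates of `y` under `T^d`. -/
noncomputable def birkhoffMean (T : StrongDual 𝕜 Y →L[𝕜] StrongDual 𝕜 Y) (d N : ℕ)
    (y : StrongDual 𝕜 Y) : StrongDual 𝕜 Y :=
  ((N : 𝕜) + 1)⁻¹ • ∑ j ∈ Finset.range (N + 1), T^[j * d] y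

/-- Balls of `𝕜` are convex. With `a = 0` this bounds the means; with `a = x u` it keeps them near
`x`. -/
theorem norm_birkhoffMean_sub_le (T : StrongDual 𝕜 Y →L[𝕜] StrongDual 𝕜 Y) {d N : ℕ}
    {y : StrongDual 𝕜 Y} {u : Y} {a : 𝕜} {r : ℝ} (h : ∀ j ≤ N, ‖(T^[j * d] y) u - a‖ ≤ r) :
    ‖birkhoffMean T d N y u - a‖ ≤ r := by
  have hN : ((N : 𝕜) + 1) ≠ 0 := by exact_mod_cast N.succ_ne_zero
  have hn : ‖(N : 𝕜) + 1‖ = N + 1 := by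
    have : ((N : 𝕜) + 1) = ((N + 1 : ℕ) : 𝕜) := by push_cast; rfl
    rw [this, RCLike.norm_natCast]; push_cast; rfl
  have key : birkhoffMean T d N y u - a =
      ((N : 𝕜) + 1)⁻¹ * ∑ j ∈ Finset.range (N + 1), ((T^[j * d] y) u - a) := by
    simp only [birkhoffMean, smul_apply, sum_apply,
      smul_eq_mul, Finset.sum_sub_distrib, Finset.sum_const, Finset.card_range, nsmul_eq_mul]
    push_cast
    field_simp
  rw [key, norm_mul, norm_inv, hn, inv_mul_le_iff₀ (by positivity)]
  refine (norm_sum_le_of_le _ fun j hj => h j (Nat.lt_succ_iff.1 (Finset.mem_range.1 hj))).trans ?_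
  simp

/-- A bounded set containing arbitrarily long pieces of `T^d`-orbits yields a fixed point of `T^d`
in every set cut out by inequalities `‖z u - x u‖ ≤ r` that contains the bounded set. -/
theorem exists_fixed_of_long_orbits [IsTopologicalAddGroup Y] [ContinuousSMul 𝕜 Y]
    {T : StrongDual 𝕜 Y →L[𝕜] StrongDual 𝕜 Y} {S : Y →ₗ[𝕜] Y}
    (hTS : ∀ (u : Y) (x : StrongDual 𝕜 Y), x (S u) = T x u) {C : Set (StrongDual 𝕜 Y)}
    (hC : ∀ ε : ℝ, 0 < ε → ∀ᶠ u in 𝓝 (0 : Y), ∀ c ∈ C, ‖c u‖ ≤ ε) {d : ℕ}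
    (horb : ∀ N : ℕ, ∃ y, ∀ j ≤ N, T^[j * d] y ∈ C) {A : Set Y} {x : StrongDual 𝕜 Y} {r : ℝ}
    (hCA : ∀ c ∈ C, ∀ u ∈ A, ‖c u - x u‖ ≤ r) :
    ∃ g : StrongDual 𝕜 Y, T^[d] g = g ∧ ∀ u ∈ A, ‖g u - x u‖ ≤ r := by
  -- One spare iterate: telescoping the `N`-th mean produces `T^[(N + 1) * d]`.
  choose y hy using fun N => horb (N + 1)
  have hyN : ∀ N, ∀ j ≤ N, T^[j * d] (y N) ∈ C := fun N j hj => hy N j (hj.trans N.le_succ)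
  obtain ⟨g, hg⟩ := exists_tendsto_apply_of_eventually_norm_apply_le (hyperfilter ℕ)
    (z := fun N => birkhoffMean T d N (y N)) (by
      intro ε hε
      filter_upwards [hC ε hε] with u hu N
      simpa using norm_birkhoffMean_sub_le T (a := 0) (N := N) (y := y N) (u := u) (d := d)
        (r := ε) (by simpa using fun j hj => hu _ (hyN N j hj)))
  refine ⟨g, ?_, fun u hu => ?_⟩
  · ext u
    rw [apply_iterate_of_adjoint hTS]
    obtain ⟨M, hM⟩ : ∃ M : ℝ, ∀ c ∈ C, ‖c u‖ ≤ M := by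
      obtain ⟨s, hs, h⟩ := (absorbent_nhds_zero (𝕜 := 𝕜) (hC 1 one_pos)).absorbs
        (x := u) |>.exists_pos
      obtain ⟨b, hb⟩ := NormedField.exists_lt_norm 𝕜 s
      obtain ⟨v, hv, rfl⟩ : u ∈ b • {u | ∀ c ∈ C, ‖c u‖ ≤ 1} := h b hb.le rfl
      refine ⟨‖b‖, fun c hc => ?_⟩
      simpa [norm_smul] using mul_le_of_le_one_right (norm_nonneg b) (hv c hc)
    have hdiff : ∀ N, birkhoffMean T d N (y N) (S^[d] u) - birkhoffMean T d N (y N) u =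
        ((N : 𝕜) + 1)⁻¹ * ((T^[(N + 1) * d] (y N)) u - (y N) u) := by
      intro N
      simp only [birkhoffMean, smul_apply, sum_apply,
        smul_eq_mul, ← mul_sub, ← Finset.sum_sub_distrib]
      congr 1
      have := Finset.sum_range_sub (fun j => (T^[j * d] (y N)) u) (N + 1)
      simp only [zero_mul, Function.iterate_zero, id] at this
      rw [← this]
      refine Finset.sum_congr rfl fun j _ => ?_
      rw [← apply_iterate_of_adjoint hTS, ← Function.iterate_add_apply, add_mul, one_mul, add_comm]
    -- The two surviving endpoints lie in `C`, hence are bounded at `u`, while the factor `1 / (N +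
    -- 1)` tends to zero.
    have hzero : Tendsto (fun N => birkhoffMean T d N (y N) (S^[d] u) -
        birkhoffMean T d N (y N) u) atTop (𝓝 0) := by
      refine squeeze_zero_norm (a := fun N : ℕ => 1 / ((N : ℝ) + 1) * (M + M)) (fun N => ?_) ?_
      · have hn : ‖(N : 𝕜) + 1‖ = N + 1 := by
          have : ((N : 𝕜) + 1) = ((N + 1 : ℕ) : 𝕜) := by push_cast; rfl
          rw [this, RCLike.norm_natCast]; push_cast; rfl
        rw [hdiff, norm_mul, norm_inv, hn, one_div]
        refine mul_le_mul_of_nonneg_left ((norm_sub_le _ _).trans (add_le_add ?_ ?_)) (by positivity)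
        · exact hM _ (hy N _ le_rfl)
        · simpa using hM _ (hy N 0 (Nat.zero_le _))
      · simpa using tendsto_one_div_add_atTop_nhds_zero_nat.mul_const (M + M)
    exact sub_eq_zero.1 (tendsto_nhds_unique ((hg (S^[d] u)).sub (hg u))
      (hzero.mono_left Nat.hyperfilter_le_atTop))
  · exact le_of_tendsto ((hg u).sub_const _).norm (Eventually.of_forall fun N =>
      norm_birkhoffMean_sub_le T fun j hj => hCA _ (hyN N j hj) u hu)

/-- Every neighbourhood in the strong dual contains a neighbourhood cut out by inequalities
`‖z u - x u‖ ≤ r`. -/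
theorem exists_forall_norm_sub_le_subset {x : StrongDual 𝕜 Y} [IsTopologicalAddGroup Y]
    [ContinuousSMul 𝕜 Y] {U : Set (StrongDual 𝕜 Y)} (hU : U ∈ 𝓝 x) :
    ∃ (A : Set Y) (r : ℝ), {z : StrongDual 𝕜 Y | ∀ u ∈ A, ‖z u - x u‖ ≤ r} ∈ 𝓝 x ∧
      {z : StrongDual 𝕜 Y | ∀ u ∈ A, ‖z u - x u‖ ≤ r} ⊆ U := by
  have hb := ContinuousLinearMap.hasBasis_nhds_zero_of_basis (σ := RingHom.id 𝕜) (E := Y)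
    (Metric.nhds_basis_closedBall (x := (0 : 𝕜)))
  have hU' : (fun z => x + z) ⁻¹' U ∈ 𝓝 (0 : StrongDual 𝕜 Y) :=
    (continuous_const_add x).continuousAt.preimage_mem_nhds (by simpa using hU)
  obtain ⟨⟨A, r⟩, ⟨hA, hr⟩, hsub⟩ := hb.mem_iff.1 hU'
  refine ⟨A, r, ?_, fun z hz => ?_⟩
  · have h := hb.mem_of_mem (i := (A, r)) ⟨hA, hr⟩
    have : Tendsto (fun z => z - x) (𝓝 x) (𝓝 0) := by
      simpa using (continuous_sub_right x).tendsto x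
    filter_upwards [this h] with z hz u hu
    simpa using hz u hu
  · have := @hsub (z - x) (fun u hu => by simpa using hz u hu)
    simpa using this

end Dual

theorem HasDenseSmallBoundedPeriodicSets.of_dense_periodicPts {𝕜 X : Type*} [NormedField 𝕜]
    [AddCommGroup X] [Module 𝕜 X] [TopologicalSpace X] [ContinuousSMul 𝕜 X] {T : X → X}
    (h : Dense (Function.periodicPts T)) : HasDenseSmallBoundedPeriodicSets 𝕜 T := by
  intro U hU hne
  obtain ⟨x, hxU, p, hp, hx⟩ := h.inter_open_nonempty U hU hne
  refine ⟨{x}, by simpa using hxU, by simp, Bornology.isVonNBounded_singleton x, p, hp, ?_⟩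
  simpa using hx.eq

theorem periodicPts_subset_locallyBoundedOrbit (𝕜 : Type*) {X : Type*} [NontriviallyNormedField 𝕜]
    [AddCommGroup X] [Module 𝕜 X] [TopologicalSpace X] [IsTopologicalAddGroup X]
    [ContinuousSMul 𝕜 X] (T : X → X) : Function.periodicPts T ⊆ locallyBoundedOrbit 𝕜 T := by
  rintro x ⟨p, hp, hx⟩
  refine ⟨Set.univ, univ_mem, ?_⟩
  refine Set.Finite.isVonNBounded (((Finset.range p).finite_toSet.image fun n => T^[n] x).subset ?_)
  rintro _ ⟨-, n, -, rfl⟩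
  exact ⟨n % p, by simpa using Nat.mod_lt n hp, hx.iterate_mod_apply n⟩

theorem periodicPts_subset_familyRec_arithProgBounded {X : Type*} [TopologicalSpace X]
    (T : X → X) : Function.periodicPts T ⊆ familyRec arithProgBounded T := by
  rintro x ⟨p, hp, hx⟩ U hU
  -- The progression starts at `p`, not `0`, because return times are at least `1`.
  refine ⟨p, hp, fun L => ⟨p, fun j _ => ⟨by omega, ?_⟩⟩⟩
  have h : T^[p + j * p] x = x := by
    rw [show p + j * p = (j + 1) * p by ring]
    exact (hx.const_mul (j + 1)).eq
  rw [h]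
  exact mem_of_mem_nhds hU

theorem theorem3p7 {𝕜 Y : Type*} [RCLike 𝕜] [AddCommGroup Y] [Module 𝕜 Y] [Module ℝ Y]
    [IsScalarTower ℝ 𝕜 Y] [TopologicalSpace Y] [IsTopologicalAddGroup Y] [ContinuousSMul 𝕜 Y]
    [T2Space Y] [LocallyConvexSpace ℝ Y]
    (hY : IsQuasiLInftyBarrelled 𝕜 Y)
    [TopologicalSpace.SeparableSpace (StrongDual 𝕜 Y)]
    [TopologicalSpace.IsCompletelyMetrizableSpace (StrongDual 𝕜 Y)]
    (T : StrongDual 𝕜 Y →L[𝕜] StrongDual 𝕜 Y) (S : Y →ₗ[𝕜] Y)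
    (hTS : ∀ (u : Y) (x : StrongDual 𝕜 Y), x (S u) = T x u) :
    List.TFAE [
      IsHypercyclic T ∧ Dense (familyRec arithProgBounded T ∩ locallyBoundedOrbit 𝕜 T),
      IsHypercyclic T ∧ HasDenseSmallBoundedPeriodicSets 𝕜 T,
      IsDevaneyChaotic T] := by
  have dense_of_long_orbits : (∀ V : Set (StrongDual 𝕜 Y), IsOpen V → V.Nonempty →
      ∃ x ∈ V, ∀ W ∈ 𝓝 x, ∃ C ⊆ W, Bornology.IsVonNBounded 𝕜 C ∧ ∃ d : ℕ, 1 ≤ d ∧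
        ∀ N : ℕ, ∃ y, ∀ j ≤ N, T^[j * d] y ∈ C) → Dense (Function.periodicPts T) := by
    intro h
    rw [dense_iff_inter_open]
    intro V hV hne
    obtain ⟨x, hx, hW⟩ := h V hV hne
    obtain ⟨A, r, hA, hAV⟩ := exists_forall_norm_sub_le_subset (hV.mem_nhds hx)
    obtain ⟨C, hCA, hC, d, hd, horb⟩ := hW _ hA
    obtain ⟨g, hg, hgA⟩ := exists_fixed_of_long_orbits hTS
      (fun ε hε => hY.eventually_norm_apply_le hC hε) horb hCA
    exact ⟨g, hAV hgA, d, hd, hg⟩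
  tfae_have 3 → 1 := fun ⟨h, hd⟩ => ⟨h, hd.mono fun _ hx =>
    ⟨periodicPts_subset_familyRec_arithProgBounded T hx,
      periodicPts_subset_locallyBoundedOrbit 𝕜 T hx⟩⟩
  tfae_have 3 → 2 := fun ⟨h, hd⟩ => ⟨h, .of_dense_periodicPts hd⟩
  tfae_have 1 → 3 := by
    rintro ⟨h, hd⟩
    refine ⟨h, dense_of_long_orbits fun V hV hne => ?_⟩
    obtain ⟨x, hxV, hrec, U, hU, hbdd⟩ := hd.inter_open_nonempty V hV hne
    refine ⟨x, hxV, fun W hW => ?_⟩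
    obtain ⟨d, hd1, hAP⟩ := hrec (W ∩ U) (inter_mem hW hU)
    refine ⟨W ∩ (U ∩ forwardOrbit T x), Set.inter_subset_left,
      hbdd.subset Set.inter_subset_right, d, hd1, fun N => ?_⟩
    obtain ⟨a, ha⟩ := hAP N
    -- A progression of return times from `a` with difference `d` is a `T^d`-orbit segment of `T^[a]
    -- x`.
    refine ⟨T^[a] x, fun j hj => ?_⟩
    obtain ⟨h1, hW', hU'⟩ := ha j hj
    rw [← Function.iterate_add_apply, add_comm]
    exact ⟨hW', hU', _, h1, rfl⟩
  tfae_have 2 → 3 := by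
    rintro ⟨h, hB⟩
    refine ⟨h, dense_of_long_orbits fun V _ ⟨x, hx⟩ => ⟨x, hx, fun W hW => ?_⟩⟩
    obtain ⟨B, hBW, ⟨y, hy⟩, hbdd, p, hp, hpB⟩ :=
      hB (interior W) isOpen_interior ⟨x, mem_interior_iff_mem_nhds.2 hW⟩
    -- Any `y ∈ B` has its whole `T^p`-orbit in `B`, so one point serves every length.
    refine ⟨B, hBW.trans interior_subset, hbdd, p, hp, fun _ => ⟨y, fun j _ => ?_⟩⟩
    rw [mul_comm, Function.iterate_mul]
    exact (Set.mapsTo_iff_image_subset.2 hpB).iterate j hy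
  tfae_finish
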